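/- All rings are associative with identity. An element $a$ of a ring is called regular if $a=aba$ for some element $b$ of the ring, and a ring is called VNL if for each of its elements $a$, either $a$ or $1-a$ is regular. Let $R$ be a ring that has no infinite set of pairwise orthogonal idempotents, and let $I$ be a nonzero two-sided ideal of $R$. Then the ring of matrices $$\begin{pmatrix} R & I\\ 0 & R\end{pmatrix}=\left\{\begin{pmatrix} r & m\\ 0 & s\end{pmatrix} : r,s\in R,\ m\in I\right\}$$ is VNL if and only if there exist a division ring $D$, a semisimple ring $S$ (the zero ring is allowed) and a ring isomorphism $\varphi: R\to D\times S$ such that $\varphi(I)=D\times 0$. -/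

import Mathlib

universe u

/-- An element `a` of a ring is (von Neumann) regular if `a = a b a` for some `b`. -/
def IsVNRegularElem {R : Type*} [Ring R] (a : R) : Prop :=
  ∃ b : R, a * b * a = a

/-- A ring is VNL (von Neumann local) if for every `a`, either `a` or `1 - a` is regular. -/
def IsVNL (R : Type*) [Ring R] : Prop :=
  ∀ a : R, IsVNRegularElem a ∨ IsVNRegularElem (1 - a)

/-- `R` contains an infinite set of pairwise orthogonal idempotents. (`Set.Pairwise` ranges over
ordered pairs, so both `e * f = 0` and `f * e = 0` are required for distinct `e`, `f`.) -/
def HasInfiniteOrthogonalIdempotents (R : Type*) [Ring R] : Prop :=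
  ∃ s : Set R, s.Infinite ∧ (∀ e ∈ s, IsIdempotentElem e) ∧ s.Pairwise (fun e f => e * f = 0)

/-- The triangular matrix ring `[[R, I], [0, R]]` for a two-sided ideal `I` of `R`, realized as the
ring of those `2 × 2` matrices over `R` whose upper right entry is in `I` and whose lower left
entry is `0`. -/
def triangularRing {R : Type*} [Ring R] (I : TwoSidedIdeal R) :
    Subring (Matrix (Fin 2) (Fin 2) R) where
  carrier := {A | A 0 1 ∈ I ∧ A 1 0 = 0}
  zero_mem' := by simp [I.zero_mem]
  one_mem' := by simp [I.zero_mem]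
  add_mem' := by
    rintro A B ⟨hA, hA'⟩ ⟨hB, hB'⟩
    exact ⟨I.add_mem hA hB, by simp [hA', hB']⟩
  neg_mem' := by
    rintro A ⟨hA, hA'⟩
    exact ⟨I.neg_mem hA, by simp [hA']⟩
  mul_mem' := by
    rintro A B ⟨hA, hA'⟩ ⟨hB, hB'⟩
    refine ⟨?_, by simp [Matrix.mul_apply, Fin.sum_univ_two, hA', hB']⟩
    simp only [Matrix.mul_apply, Fin.sum_univ_two]
    exact I.add_mem (I.mul_mem_left _ _ hB) (I.mul_mem_right _ _ hA)

/-! If the triangular ring is VNL, diagonal test matrices make `R` regular, hence semisimple by the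
finiteness hypothesis, and `I = hR` with `h` a central idempotent. Test matrices with corner entry
`h` leave only the idempotents `0` and `h` in `I`, so `hR` is a division ring. Conversely, over `D ×
S` either `r` or `1 - r` has nonzero `D`-component, and a corner entry in `D × 0` can then be
cleared by a column operation. -/

variable {R : Type*} [Ring R]

/-- If every idempotent satisfying `P` can be enlarged by an orthogonal nonzero idempotent, within
`P`, then there are infinitely many pairwise orthogonal idempotents. -/
lemma HasInfiniteOrthogonalIdempotents.of_step (P : R → Prop) (h0 : P 0)
    (step : ∀ e, P e → IsIdempotentElem e →
      ∃ g, g ≠ 0 ∧ IsIdempotentElem g ∧ e * g = 0 ∧ g * e = 0 ∧ P (e + g)) :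
    HasInfiniteOrthogonalIdempotents R := by
  have step' : ∀ e : {e : R // P e ∧ IsIdempotentElem e},
      ∃ g, g ≠ 0 ∧ IsIdempotentElem g ∧ e.1 * g = 0 ∧ g * e.1 = 0 ∧ P (e.1 + g) :=
    fun e => step e.1 e.2.1 e.2.2
  choose g hg0 hgi heg hge hP using step'
  have hidem : ∀ e : {e : R // P e ∧ IsIdempotentElem e}, IsIdempotentElem (e.1 + g e) := by
    intro e
    have h1 : e.1 * e.1 = e.1 := e.2.2
    have h2 : g e * g e = g e := hgi e
    simp [IsIdempotentElem, mul_add, add_mul, h1, h2, heg, hge]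
  let E : ℕ → {e : R // P e ∧ IsIdempotentElem e} := fun n =>
    Nat.rec ⟨0, h0, by simp [IsIdempotentElem]⟩ (fun _ e => ⟨e.1 + g e, hP e, hidem e⟩) n
  have hE : ∀ n, (E (n + 1)).1 = (E n).1 + g (E n) := fun n => rfl
  -- Each chosen `g (E n)` is absorbed by all later partial sums, to which later choices are
  -- orthogonal.
  have absorb : ∀ n k, (E (n + 1 + k)).1 * g (E n) = g (E n) ∧
      g (E n) * (E (n + 1 + k)).1 = g (E n) ∧
      g (E (n + 1 + k)) * g (E n) = 0 ∧ g (E n) * g (E (n + 1 + k)) = 0 := by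
    intro n k
    have key : ∀ k, (E (n + 1 + k)).1 * g (E n) = g (E n) ∧
        g (E n) * (E (n + 1 + k)).1 = g (E n) →
        g (E (n + 1 + k)) * g (E n) = 0 ∧ g (E n) * g (E (n + 1 + k)) = 0 := by
      rintro k ⟨h1, h2⟩
      constructor
      · rw [← h1, ← mul_assoc, hge, zero_mul]
      · rw [← h2, mul_assoc, heg, mul_zero]
    suffices h : (E (n + 1 + k)).1 * g (E n) = g (E n) ∧
        g (E n) * (E (n + 1 + k)).1 = g (E n) from ⟨h.1, h.2, key k h⟩
    induction k with
    | zero =>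
      have h2 : g (E n) * g (E n) = g (E n) := hgi _
      simp [hE, add_mul, mul_add, heg, hge, h2]
    | succ k ih =>
      have hk := key k ih
      rw [← add_assoc, hE, add_mul, mul_add, ih.1, ih.2, hk.1, hk.2, add_zero]
      exact ⟨rfl, rfl⟩
  have ortho : ∀ m n, m ≠ n → g (E m) * g (E n) = 0 := by
    intro m n hmn
    rcases lt_or_gt_of_ne hmn with h | h
    · obtain ⟨k, rfl⟩ := Nat.exists_eq_add_of_le (Nat.succ_le_of_lt h)
      exact (absorb m k).2.2.2
    · obtain ⟨k, rfl⟩ := Nat.exists_eq_add_of_le (Nat.succ_le_of_lt h)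
      exact (absorb n k).2.2.1
  have inj : Function.Injective fun n => g (E n) := by
    intro m n hmn
    by_contra hne
    have h1 := ortho m n hne
    have h2 : g (E m) = g (E n) := hmn
    rw [h2, (hgi (E n)).eq] at h1
    exact hg0 _ h1
  refine ⟨Set.range fun n => g (E n), Set.infinite_range_of_injective inj, ?_, ?_⟩
  · rintro _ ⟨n, rfl⟩
    exact hgi _
  · rintro _ ⟨m, rfl⟩ _ ⟨n, rfl⟩ hne
    exact ortho m n fun h => hne (by rw [h])

/-- In a von Neumann regular ring without infinite sets of pairwise orthogonal idempotents, every
left ideal is generated by an idempotent. -/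
lemma exists_idempotent_right_identity (hR : ¬ HasInfiniteOrthogonalIdempotents R)
    (hreg : ∀ a : R, IsVNRegularElem a) (L : Ideal R) :
    ∃ e ∈ L, IsIdempotentElem e ∧ ∀ x ∈ L, x * e = x := by
  by_contra! hcon
  refine hR (.of_step (· ∈ L) L.zero_mem fun e heL he => ?_)
  obtain ⟨x, hxL, hx⟩ := hcon e heL he
  have he' : e * e = e := he
  set y := x - x * e with hy
  have hye : y * e = 0 := by rw [hy, sub_mul, mul_assoc, he', sub_self]
  have hy0 : y ≠ 0 := fun h => hx (sub_eq_zero.mp h).symm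
  have hyL : y ∈ L := L.sub_mem hxL (L.mul_mem_left _ heL)
  obtain ⟨b, hb⟩ := hreg y
  set f := b * y with hf
  have hff : f * f = f := by rw [hf, mul_assoc, ← mul_assoc y, hb]
  have hfe : f * e = 0 := by rw [hf, mul_assoc, hye, mul_zero]
  have hfL : f ∈ L := L.mul_mem_left _ hyL
  have hfef : f * (e * f) = 0 := by rw [← mul_assoc, hfe, zero_mul]
  have heef : e * (e * f) = e * f := by rw [← mul_assoc, he']
  -- Only `f * e = 0` is known; subtracting `e * f` gives orthogonality on the other side too.
  refine ⟨f - e * f, fun h => hy0 ?_, ?_, ?_, ?_,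
    L.add_mem heL (L.sub_mem hfL (L.mul_mem_left _ hfL))⟩
  · have h1 : f = e * f := sub_eq_zero.mp h
    have h2 : f = 0 := by rw [← hff]; nth_rw 2 [h1]; exact hfef
    rw [← hb, mul_assoc, ← hf, h2, mul_zero]
  · simp only [IsIdempotentElem, sub_mul, mul_sub, mul_assoc, hff, hfef, mul_zero, sub_zero]
  · rw [mul_sub, heef, sub_self]
  · rw [sub_mul, mul_assoc e, hfe, mul_zero, sub_zero]

lemma isSemisimpleRing_of_regular (hR : ¬ HasInfiniteOrthogonalIdempotents R)
    (hreg : ∀ a : R, IsVNRegularElem a) : IsSemisimpleRing R := by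
  refine (isSemisimpleModule_iff R R).mpr ⟨fun (L : Ideal R) => ?_⟩
  obtain ⟨e, heL, he, hL⟩ := exists_idempotent_right_identity hR hreg L
  have he' : e * e = e := he
  refine ⟨Ideal.span {1 - e}, ?_, ?_⟩
  · rw [disjoint_iff, eq_bot_iff]
    rintro x ⟨hx1, hx2⟩
    obtain ⟨c, rfl⟩ := Ideal.mem_span_singleton'.mp hx2
    have := hL _ hx1
    rw [mul_assoc, sub_mul, one_mul, he', sub_self, mul_zero] at this
    exact this.symm
  · rw [codisjoint_iff, eq_top_iff]
    intro x _
    refine Submodule.mem_sup.mpr ⟨x * e, L.mul_mem_left _ heL, x * (1 - e),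
      Ideal.mul_mem_left _ _ (Ideal.subset_span rfl), by noncomm_ring⟩

lemma IsSemisimpleRing.isVNRegularElem [IsSemisimpleRing R] (a : R) : IsVNRegularElem a := by
  obtain ⟨e, he, hspan⟩ := IsSemisimpleRing.ideal_eq_span_idempotent (Ideal.span {a})
  have h1 : a ∈ Ideal.span {e} := hspan ▸ Ideal.subset_span rfl
  have h2 : e ∈ Ideal.span {a} := hspan ▸ Ideal.subset_span rfl
  obtain ⟨c, hc⟩ := Ideal.mem_span_singleton'.mp h1
  obtain ⟨b, hb⟩ := Ideal.mem_span_singleton'.mp h2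
  refine ⟨b, ?_⟩
  rw [mul_assoc, hb, ← hc, mul_assoc, he.eq]

namespace triangularRing

variable {I : TwoSidedIdeal R}

/-- The triangular matrix with rows `(r, m)` and `(0, s)`. -/
def mk (r s : R) (m : R) (hm : m ∈ I) : triangularRing I :=
  ⟨!![r, m; 0, s], by exact ⟨hm, rfl⟩⟩

lemma exists_eq_mk (A : triangularRing I) : ∃ r s m, ∃ hm : m ∈ I, A = mk r s m hm := by
  obtain ⟨A, hA, hA'⟩ := A
  exact ⟨A 0 0, A 1 1, A 0 1, hA, Subtype.ext (by
    ext i j; fin_cases i <;> fin_cases j <;> simp [mk, hA'])⟩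

lemma one_sub_mk (r s m : R) (hm : m ∈ I) :
    1 - mk r s m hm = mk (1 - r) (1 - s) (-m) (I.neg_mem hm) :=
  Subtype.ext (by ext i j; fin_cases i <;> fin_cases j <;> simp [mk])

lemma isVNRegularElem_mk_iff {r s m : R} {hm : m ∈ I} :
    IsVNRegularElem (mk r s m hm) ↔ ∃ x y z, y ∈ I ∧ r * x * r = r ∧ s * z * s = s ∧
      r * x * m + r * y * s + m * z * s = m := by
  have mul (x z y : R) (hy : y ∈ I) : mk r s m hm * mk x z y hy * mk r s m hm = mk r s m hm ↔
      r * x * r = r ∧ s * z * s = s ∧ r * x * m + r * y * s + m * z * s = m := by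
    rw [Subtype.ext_iff, ← Matrix.ext_iff]
    simp [mk, Fin.forall_fin_two, add_mul, ← add_assoc]
    tauto
  constructor
  · rintro ⟨B, hB⟩
    obtain ⟨x, z, y, hy, rfl⟩ := exists_eq_mk B
    exact ⟨x, y, z, hy, (mul x z y hy).mp hB⟩
  · rintro ⟨x, y, z, hy, h⟩
    exact ⟨mk x z y hy, (mul x z y hy).mpr h⟩

/-- The matrix is `diag(r, s)` multiplied by unipotents with corners `q` (left) and `p` (right);
undoing these on `diag(x, z)` gives the corner `-(x * q + p * z)`. -/
lemma isVNRegularElem_mk {r s m p q : R} (hm : m ∈ I) (hr : IsVNRegularElem r)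
    (hs : IsVNRegularElem s) (hp : p ∈ I) (hq : q ∈ I) (h : m = r * p + q * s) :
    IsVNRegularElem (mk r s m hm) := by
  obtain ⟨x, hx⟩ := hr
  obtain ⟨z, hz⟩ := hs
  refine isVNRegularElem_mk_iff.mpr ⟨x, -(x * q + p * z), z,
    I.neg_mem (I.add_mem (I.mul_mem_left _ _ hq) (I.mul_mem_right _ _ hp)), hx, hz, ?_⟩
  calc r * x * m + r * -(x * q + p * z) * s + m * z * s
      = (r * x * r) * p + q * (s * z * s) := by rw [h]; noncomm_ring
    _ = m := by rw [hx, hz, h]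

end triangularRing

/-- `diag(r, 1 - r)` and its complement both have `r` on the diagonal. -/
lemma IsVNL.isVNRegularElem_of_triangularRing {I : TwoSidedIdeal R}
    (h : IsVNL (triangularRing I)) (r : R) : IsVNRegularElem r := by
  rcases h (triangularRing.mk r (1 - r) 0 I.zero_mem) with h | h
  · obtain ⟨x, -, -, -, hx, -⟩ := triangularRing.isVNRegularElem_mk_iff.mp h
    exact ⟨x, hx⟩
  · rw [triangularRing.one_sub_mk] at h
    obtain ⟨-, -, z, -, -, hz, -⟩ := triangularRing.isVNRegularElem_mk_iff.mp h
    exact ⟨z, by simpa using hz⟩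

/-- Any two-sided ideal of a von Neumann regular ring without infinite sets of orthogonal idempotents
is generated by a central idempotent. -/
lemma exists_central_idempotent (hR : ¬ HasInfiniteOrthogonalIdempotents R)
    (hreg : ∀ a : R, IsVNRegularElem a) (I : TwoSidedIdeal R) :
    ∃ h ∈ I, (∀ x ∈ I, h * x = x) ∧ ∀ r, h * r = r * h := by
  obtain ⟨h, hh, -, hright⟩ := exists_idempotent_right_identity hR hreg I.asIdeal
  have hI : h ∈ I := by simpa using hh
  have hright : ∀ x ∈ I, x * h = x := fun x hx => hright x (by simpa using hx)
  have hleft : ∀ x ∈ I, h * x = x := by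
    intro x hx
    have hy : x - h * x ∈ I := I.sub_mem hx (I.mul_mem_left _ _ hx)
    obtain ⟨b, hb⟩ := hreg (x - h * x)
    have h0 : h * (x - h * x) = 0 := by
      rw [mul_sub, ← mul_assoc, hright h hI, sub_self]
    -- With `y = x - h * x`: `y * b ∈ I` gives `y = y * b * y = y * b * (h * y) = 0`.
    rw [← hright _ (I.mul_mem_right _ b hy), mul_assoc, h0, mul_zero] at hb
    exact (sub_eq_zero.mp hb.symm).symm
  refine ⟨h, hI, hleft, fun r => ?_⟩
  rw [← hright (h * r) (I.mul_mem_right _ _ hI), mul_assoc, hleft _ (I.mul_mem_left _ _ hI)]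

/-- The product decomposition of a ring given by a central idempotent. -/
def IsIdempotentElem.prodCornerEquiv {h : R} (hh : IsIdempotentElem h)
    (hc : ∀ r, h * r = r * h) : R ≃+* hh.Corner × hh.one_sub.Corner where
  toFun r := (⟨_, r, rfl⟩, ⟨_, r, rfl⟩)
  invFun p := p.1.1 + p.2.1
  left_inv r := by
    have hh' : h * h = h := hh
    have h1 : h * r * h = h * r := by rw [mul_assoc, ← hc r, ← mul_assoc, hh']
    have : (1 - h) * r * (1 - h) = r - h * r - r * h + h * r * h := by noncomm_ring
    simp only [this, h1, ← hc r]
    abel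
  right_inv := by
    have hh' : h * h = h := hh
    rintro ⟨⟨_, a, rfl⟩, ⟨_, b, rfl⟩⟩
    have e1 : h * (1 - h) = 0 := by rw [mul_sub, hh', mul_one, sub_self]
    have e3 : (1 - h) * (1 - h) = 1 - h := hh.one_sub
    refine Prod.ext (Subtype.ext ?_) (Subtype.ext ?_)
    · change h * (h * a * h + (1 - h) * b * (1 - h)) * h = h * a * h
      calc _ = (h * h) * a * (h * h) + (h * (1 - h)) * b * ((1 - h) * h) := by
            simp only [mul_add, add_mul, mul_assoc]
        _ = _ := by rw [hh', e1]; simp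
    · change (1 - h) * (h * a * h + (1 - h) * b * (1 - h)) * (1 - h) = (1 - h) * b * (1 - h)
      calc _ = ((1 - h) * h) * a * (h * (1 - h)) + ((1 - h) * (1 - h)) * b * ((1 - h) * (1 - h)) := by
            simp only [mul_add, add_mul, mul_assoc]
        _ = _ := by rw [e3, e1]; simp
  map_mul' a b := by
    have key : ∀ e : R, e * e = e → (∀ r, e * r = r * e) →
        e * (a * b) * e = e * a * e * (e * b * e) := by
      intro e he hc
      calc e * (a * b) * e = e * e * a * b * e := by rw [he]; simp only [mul_assoc]
        _ = e * (e * a) * b * e := by simp only [mul_assoc]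
        _ = e * a * e * b * e := by nth_rw 1 [hc a]; simp only [mul_assoc]
        _ = e * a * (e * e) * b * e := by rw [he]
        _ = _ := by simp only [mul_assoc]
    exact Prod.ext (Subtype.ext (key h hh hc)) (Subtype.ext (key (1 - h) hh.one_sub fun r => by
      rw [sub_mul, mul_sub, hc, one_mul, mul_one]))
  map_add' a b := Prod.ext
    (Subtype.ext (by change _ = h * a * h + h * b * h; noncomm_ring))
    (Subtype.ext (by change _ = (1 - h) * a * (1 - h) + (1 - h) * b * (1 - h); noncomm_ring))

/-- Regularity of the matrix with diagonal `g, g` and corner `h` puts `h` in `gR + Rg`, which `1 -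
g` on both sides kills; for the complement, `g` plays that role. -/
lemma IsVNL.eq_zero_or_eq_of_idempotent {I : TwoSidedIdeal R} (hV : IsVNL (triangularRing I))
    {h : R} (hI : h ∈ I) (hleft : ∀ x ∈ I, h * x = x) (hc : ∀ r, h * r = r * h)
    {g : R} (hgI : g ∈ I) (hg : IsIdempotentElem g) : g = 0 ∨ g = h := by
  have hg' : g * g = g := hg
  have e1 : (1 - g) * g = 0 := by rw [sub_mul, hg', one_mul, sub_self]
  have e2 : g * (1 - g) = 0 := by rw [mul_sub, hg', mul_one, sub_self]
  have e3 : (1 - g) * (1 - g) = 1 - g := hg.one_sub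
  rcases hV (triangularRing.mk g g h hI) with hA | hA
  · obtain ⟨x, y, z, -, -, -, hm⟩ := triangularRing.isVNRegularElem_mk_iff.mp hA
    right
    have h1 : (1 - g) * h * (1 - g) = 0 := by
      rw [← hm]
      calc _ = ((1 - g) * g) * (x * h + y * g) * (1 - g) + (1 - g) * h * z * (g * (1 - g)) := by
            simp only [mul_add, add_mul, mul_assoc]
        _ = 0 := by rw [e1, e2]; simp
    rw [← hc, mul_assoc, e3, mul_sub, mul_one, hleft g hgI] at h1
    exact (sub_eq_zero.mp h1).symm
  · rw [triangularRing.one_sub_mk] at hA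
    obtain ⟨x, y, z, -, -, -, hm⟩ := triangularRing.isVNRegularElem_mk_iff.mp hA
    left
    have h1 : g * (-h) * g = 0 := by
      rw [← hm]
      calc _ = (g * (1 - g)) * (x * (-h) + y * (1 - g)) * g + g * (-h) * z * ((1 - g) * g) := by
            simp only [mul_add, add_mul, mul_assoc]
        _ = 0 := by rw [e1, e2]; simp
    simpa [← hc, mul_assoc, hg', hleft g hgI] using h1

/-- For `a ≠ 0` with `a * b * a = a`, the idempotents `b * a` and `a * b` are nonzero, so both equal
`h`. -/
lemma isUnit_or_eq_zero_corner {h : R} (hh : IsIdempotentElem h)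
    (hreg : ∀ a : R, IsVNRegularElem a) (hc : ∀ r, h * r = r * h)
    (hidem : ∀ g : R, h * g = g → IsIdempotentElem g → g = 0 ∨ g = h) (a : hh.Corner) :
    IsUnit a ∨ a = 0 := by
  obtain ⟨a, ha⟩ := a
  have hha : h * a = a := ((Subsemigroup.mem_corner_iff hh).mp ha).1
  obtain ⟨b, hb⟩ := hreg a
  have hba : h * (b * a) = b * a := by rw [← mul_assoc, hc, mul_assoc, hha]
  have hab : h * (a * b) = a * b := by rw [← mul_assoc, hha]
  by_cases ha0 : a = 0
  · exact .inr (Subtype.ext ha0)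
  left
  have h1 : b * a = h := (hidem _ hba (by
    rw [IsIdempotentElem, mul_assoc, ← mul_assoc a, hb])).resolve_left fun h0 => ha0 (by
    rw [← hb, mul_assoc, h0, mul_zero])
  have h2 : a * b = h := (hidem _ hab (by
    rw [IsIdempotentElem, ← mul_assoc, hb])).resolve_left fun h0 => ha0 (by
    rw [← hb, h0, zero_mul])
  have hh' : h * h = h := hh
  refine ⟨⟨⟨a, ha⟩, ⟨h * b * h, b, rfl⟩, Subtype.ext ?_, Subtype.ext ?_⟩, rfl⟩
  · change a * (h * b * h) = h
    rw [hc b, mul_assoc, hh', ← mul_assoc, h2, hh']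
  · change h * b * h * a = h
    rw [mul_assoc, hha, mul_assoc, h1, hh']

theorem isVNL_triangularRing_of_prod {D S : Type*} [DivisionRing D] [Ring S] [IsSemisimpleRing S]
    (φ : R ≃+* D × S) {I : TwoSidedIdeal R} (hφ : ∀ x : R, x ∈ I ↔ (φ x).2 = 0) :
    IsVNL (triangularRing I) := by
  have hreg : ∀ a : R, IsVNRegularElem a := by
    intro a
    obtain ⟨b, hb⟩ := IsSemisimpleRing.isVNRegularElem (φ a).2
    refine ⟨φ.symm ((φ a).1⁻¹, b), φ.injective (Prod.ext ?_ ?_)⟩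
    · simp
    · simpa using hb
  -- `m` lives in the `D`-component, so a diagonal entry invertible there divides it.
  have main : ∀ r s m (hm : m ∈ I), (φ r).1 ≠ 0 ∨ (φ s).1 ≠ 0 →
      IsVNRegularElem (triangularRing.mk r s m hm) := by
    rintro r s m hm (h | h)
    · refine triangularRing.isVNRegularElem_mk (p := φ.symm ((φ r).1⁻¹ * (φ m).1, 0)) (q := 0) hm
        (hreg r) (hreg s) ((hφ _).mpr (by simp)) I.zero_mem (φ.injective (Prod.ext ?_ ?_))
      · simp [h]
      · simpa using (hφ m).mp hm
    · refine triangularRing.isVNRegularElem_mk (p := 0) (q := φ.symm ((φ m).1 * (φ s).1⁻¹, 0)) hm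
        (hreg r) (hreg s) I.zero_mem ((hφ _).mpr (by simp)) (φ.injective (Prod.ext ?_ ?_))
      · simp [h]
      · simpa using (hφ m).mp hm
  intro A
  obtain ⟨r, s, m, hm, rfl⟩ := triangularRing.exists_eq_mk A
  by_cases h : (φ r).1 = 0
  · right
    rw [triangularRing.one_sub_mk]
    exact main _ _ _ _ (.inl (by simp [h]))
  · exact .inl (main _ _ _ _ (.inl h))

theorem corollary2p17 {R : Type u} [Ring R] (hR : ¬ HasInfiniteOrthogonalIdempotents R)
    (I : TwoSidedIdeal R) (hI : I ≠ ⊥) :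
    IsVNL (triangularRing I) ↔
      ∃ (D S : Type u) (_ : DivisionRing D) (_ : Ring S) (φ : R ≃+* D × S),
        IsSemisimpleRing S ∧ ∀ x : R, x ∈ I ↔ (φ x).2 = 0 := by
  constructor
  · intro hV
    have hreg := hV.isVNRegularElem_of_triangularRing
    have : IsSemisimpleRing R := isSemisimpleRing_of_regular hR hreg
    obtain ⟨h, hhI, hleft, hc⟩ := exists_central_idempotent hR hreg I
    have hh : IsIdempotentElem h := hleft h hhI
    have hmem : ∀ x, h * x = x → x ∈ I := fun x hx => hx ▸ I.mul_mem_right _ _ hhI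
    have hne : h ≠ 0 := by
      rintro rfl
      refine hI (eq_bot_iff.mpr fun x hx => ?_)
      rw [← hleft x hx, zero_mul]
      exact TwoSidedIdeal.zero_mem _
    have : Nontrivial hh.Corner := ⟨1, 0, fun h0 => hne (congrArg Subtype.val h0)⟩
    let φ := hh.prodCornerEquiv hc
    refine ⟨hh.Corner, hh.one_sub.Corner,
      DivisionRing.ofIsUnitOrEqZero (isUnit_or_eq_zero_corner hh hreg hc fun g hg hgi =>
        hV.eq_zero_or_eq_of_idempotent hhI hleft hc (hmem g hg) hgi),
      inferInstance, φ, ?_, fun x => ?_⟩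
    · exact ((RingHom.snd hh.Corner hh.one_sub.Corner).comp
        φ.toRingHom).isSemisimpleRing_of_surjective (Prod.snd_surjective.comp φ.surjective)
    · have h2 : (φ x).2 = 0 ↔ (1 - h) * x * (1 - h) = 0 := Subtype.ext_iff
      have hh' : h * h = h := hh
      have h3 : (1 - h) * x * (1 - h) = x - h * x := by
        calc _ = x - h * x - x * h + h * (x * h) := by noncomm_ring
          _ = x - h * x := by rw [← hc x, ← mul_assoc, hh']; abel
      rw [h2, h3, sub_eq_zero]
      exact ⟨fun hx => (hleft x hx).symm, fun hx => hmem x hx.symm⟩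
  · rintro ⟨D, S, _, _, φ, hS, hφ⟩
    exact isVNL_triangularRing_of_prod φ hφ
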